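/- Let $\Gamma$ be a cancellation monoid (not necessarily commutative), written multiplicatively, and let $R=\bigoplus_{\alpha\in\Gamma}R_\alpha$ be a $\Gamma$-graded commutative integral domain, i.e. the $R_\alpha$ are additive subgroups with $R_\alpha R_\beta\subseteq R_{\alpha\beta}$. An ideal is homogeneous if it is generated by homogeneous elements. Call $R$ a graded-Prüfer domain if every nonzero finitely generated homogeneous ideal of $R$ is invertible, and graded coherent if every finitely generated homogeneous ideal of $R$ is a finitely presented $R$-module. A $\Gamma$-graded left (resp. right) $R$-module is an $R$-module $M=\bigoplus_{\beta\in\Gamma}M_\beta$, the $M_\beta$ being additive subgroups, with $R_\alpha M_\beta\subseteq M_{\alpha\beta}$ (resp. $M_\beta R_\alpha\subseteq M_{\beta\alpha}$) for all $\alpha,\beta\in\Gamma$. The graded left (resp. right) weak dimension of $R$ is $$\sup\{\operatorname{fd}_R(M)\mid M\text{ a }\Gamma\text{-graded left (resp. right) }R\text{-module}\},$$ where the flat dimension $\operatorname{fd}_R(M)\in\{0,1,2,\dots,\infty\}$ is the least $n$ such that there is an exact sequence $0\to F_n\to\cdots\to F_0\to M\to 0$ with all $F_i$ flat $R$-modules,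 and $\infty$ if there is no such $n$. The graded left and right weak dimensions are known to coincide; their common value is denoted $\text{gr-wD}(R)$. Then $R$ is a graded-Prüfer domain if and only if $R$ is graded coherent and $\text{gr-wD}(R)\le 1$ (where $\text{gr-wD}(R)$ may be computed either as the graded left weak dimension or as the graded right weak dimension). Moreover, $R$ is a graded-Prüfer domain if and only if every nonzero finitely generated homogeneous ideal of $R$ is a projective $R$-module. -/

import Mathlib

/-!
The grading monoid is written additively, as Mathlib does for graded rings. It is not assumed to be
commutative, so the order of the summands in a degree matters.
-/

namespace GradedPrufer

universe u v

section FlatDimension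

variable (R : Type u) [CommRing R] (M : Type u) [AddCommGroup M] [Module R M]

/-- `M` has a flat resolution `0 → F n → ⋯ → F 1 → F 0 → M → 0`. The resolution is written as an
infinite exact sequence whose terms `F i` vanish for `i > n`. -/
def HasFlatResolutionOfLength (n : ℕ) : Prop :=
  ∃ (F : ℕ → ModuleCat.{u} R) (d : ∀ i, F (i + 1) →ₗ[R] F i) (ε : F 0 →ₗ[R] M),
    (∀ i, Module.Flat R (F i)) ∧
    Function.Surjective ε ∧
    Function.Exact (d 0) ε ∧
    (∀ i, Function.Exact (d (i + 1)) (d i)) ∧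
    ∀ i, n < i → Subsingleton (F i)

/-- The flat dimension of `M`: the length of a shortest finite flat resolution, and `⊤` if there is
none. -/
noncomputable def flatDim : ℕ∞ :=
  ⨅ (n : ℕ) (_ : HasFlatResolutionOfLength R M n), (n : ℕ∞)

end FlatDimension

section Graded

variable {Γ : Type v} {R : Type u} [DecidableEq Γ] [AddCancelMonoid Γ] [CommRing R]
variable (𝒜 : Γ → AddSubgroup R)

/-- `ℳ` makes `M` a `Γ`-graded left module over the graded ring `R = ⨁ α, 𝒜 α`:
`M = ⨁ β, ℳ β` (internally) and `𝒜 α • ℳ β ⊆ ℳ (α + β)`. -/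
def IsGradedLeftModule {M : Type u} [AddCommGroup M] [Module R M] (ℳ : Γ → AddSubgroup M) : Prop :=
  DirectSum.IsInternal ℳ ∧
    ∀ (α β : Γ) (r : R) (m : M), r ∈ 𝒜 α → m ∈ ℳ β → r • m ∈ ℳ (α + β)

/-- `ℳ` makes `M` a `Γ`-graded right module over the graded ring `R = ⨁ α, 𝒜 α`:
`M = ⨁ β, ℳ β` (internally) and `ℳ β • 𝒜 α ⊆ ℳ (β + α)`. As `R` is commutative, the right action of
`r` on `m` is written `r • m`; right graded modules differ from left ones only in the order of the
degrees. -/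
def IsGradedRightModule {M : Type u} [AddCommGroup M] [Module R M] (ℳ : Γ → AddSubgroup M) : Prop :=
  DirectSum.IsInternal ℳ ∧
    ∀ (α β : Γ) (r : R) (m : M), r ∈ 𝒜 α → m ∈ ℳ β → r • m ∈ ℳ (β + α)

/-- The graded left weak dimension: the supremum of the flat dimensions of the graded left
modules. -/
noncomputable def gradedLeftWeakDim : ℕ∞ :=
  sSup {d | ∃ (M : Type u) (_ : AddCommGroup M) (_ : Module R M) (ℳ : Γ → AddSubgroup M),
    IsGradedLeftModule 𝒜 ℳ ∧ d = flatDim R M}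

/-- The graded right weak dimension: the supremum of the flat dimensions of the graded right
modules. -/
noncomputable def gradedRightWeakDim : ℕ∞ :=
  sSup {d | ∃ (M : Type u) (_ : AddCommGroup M) (_ : Module R M) (ℳ : Γ → AddSubgroup M),
    IsGradedRightModule 𝒜 ℳ ∧ d = flatDim R M}

variable [GradedRing 𝒜]

/-- Every finitely generated homogeneous ideal is finitely presented as a module. -/
def IsGradedCoherent : Prop :=
  ∀ I : Ideal R, I.IsHomogeneous 𝒜 → I.FG → Module.FinitePresentation R I

/-- Every nonzero finitely generated homogeneous ideal is invertible, as a fractional ideal in the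
field of fractions of the domain `R`. -/
def IsGradedPrufer [IsDomain R] : Prop :=
  ∀ I : Ideal R, I.IsHomogeneous 𝒜 → I.FG → I ≠ ⊥ →
    IsUnit (I : FractionalIdeal (nonZeroDivisors R) (FractionRing R))

end Graded

end GradedPrufer

namespace GradedPrufer

universe u v

open DirectSum

/-! Over a domain a nonzero ideal is invertible iff it is projective, so graded-Prüfer means that
all finitely generated homogeneous ideals are projective. If R is graded coherent of graded weak
dimension at most 1, then R/I is graded for homogeneous I, so I is flat; when I is finitely
generated it is also finitely presented, hence projective.

Conversely, finitely generated projective ideals are finitely presented. A graded module M is the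
image of a free module on its homogeneous elements, with kernel K closed under homogeneous
components. K is a directed union of finitely generated submodules closed in the same way
(`exists_fg_isComponentClosed`). Each of these is projective (`projective_of_isComponentClosed`):
its image in one coordinate is a finitely generated homogeneous ideal, which splits off, and
induction on the coordinates applies. So K is flat and fd M ≤ 1. -/

/-! ### Invertible and projective ideals -/

theorem projective_of_isUnit_coeIdeal {R : Type*} [CommRing R] [IsDomain R] {I : Ideal R}
    (h : IsUnit (I : FractionalIdeal (nonZeroDivisors R) (FractionRing R))) :
    Module.Projective R I := by
  have h' : Module.Projective R (Submodule.map (Algebra.linearMap R (FractionRing R)) I) := Submodule.projective_of_isUnit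
    (h.map (FractionalIdeal.coeSubmoduleHom (nonZeroDivisors R) (FractionRing R)))
  exact .of_equiv (Submodule.equivMapOfInjective (Algebra.linearMap R (FractionRing R))
    (IsFractionRing.injective R (FractionRing R)) I).symm

/-- Dual basis argument: for a section `s` and fixed `a ≠ 0` in I, `s x y = x * (s a y / a)`, so
each `s a y / a` lies in the inverse of I, and `∑ y * (s a y / a) = 1`. -/
theorem isUnit_coeIdeal_of_projective {R : Type*} [CommRing R] [IsDomain R] {I : Ideal R}
    (hI : I ≠ ⊥) [Module.Projective R I] :
    IsUnit (I : FractionalIdeal (nonZeroDivisors R) (FractionRing R)) := by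
  set K := FractionRing R
  obtain ⟨s, hs⟩ := Module.projective_def'.1 ‹Module.Projective R I›
  obtain ⟨a, haI, ha⟩ := Submodule.exists_mem_ne_zero_of_ne_bot hI
  have ha' : algebraMap R K a ≠ 0 := by simpa using ha
  have hI' : (I : FractionalIdeal (nonZeroDivisors R) K) ≠ 0 :=
    FractionalIdeal.coeIdeal_ne_zero.2 hI
  have hsa (x : I) (y : I) : a * s x y = x * s ⟨a, haI⟩ y := by
    have : s (a • x) = s ((x : R) • (⟨a, haI⟩ : I)) := by
      congr 1; ext; simp [mul_comm]
    rw [map_smul, map_smul] at this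
    exact DFunLike.congr_fun this y
  rw [← FractionalIdeal.mul_inv_cancel_iff_isUnit]
  refine le_antisymm ?_ ?_
  · rw [FractionalIdeal.mul_le]
    intro x hx y hy
    rw [mul_comm]
    exact (FractionalIdeal.mem_inv_iff hI').1 hy x hx
  · rw [FractionalIdeal.one_le]
    have h1 : ((s ⟨a, haI⟩).sum fun y r ↦ r * (y : R)) = a := by
      have := congr((($hs ⟨a, haI⟩ : I) : R))
      simpa [Finsupp.linearCombination_apply, Finsupp.sum] using this
    have h2 : (1 : K) = (s ⟨a, haI⟩).sum
        fun y r ↦ algebraMap R K y * (algebraMap R K r / algebraMap R K a) := by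
      rw [← mul_left_inj' ha', one_mul, Finsupp.sum, Finset.sum_mul]
      conv_lhs => rw [← h1, Finsupp.sum, map_sum]
      refine Finset.sum_congr rfl fun _ _ ↦ ?_
      rw [mul_assoc, div_mul_cancel₀ _ ha', map_mul, mul_comm]
    rw [h2]
    refine Submodule.sum_mem (FractionalIdeal.coeToSubmodule _) fun y _ ↦ ?_
    refine FractionalIdeal.mul_mem_mul (FractionalIdeal.mem_coeIdeal_of_mem _ y.2) ?_
    rw [FractionalIdeal.mem_inv_iff hI']
    intro z hz
    obtain ⟨x, hx, rfl⟩ := (FractionalIdeal.mem_coeIdeal _).1 hz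
    refine (FractionalIdeal.mem_one_iff _).2 ⟨s ⟨x, hx⟩ y, ?_⟩
    rw [div_mul_eq_mul_div, eq_div_iff ha', ← map_mul, ← map_mul, mul_comm, hsa, mul_comm]

/-! ### Flat dimension at most one -/

/-- Equational criterion in place of Tor: a relation in the kernel trivializes in P through `y`.
Since `q ∘ y` kills `a`, it factors as `z ∘ b` with `b ∘ a = 0`. Subtracting a lift of `z` moves `y`
into the kernel without changing `y ∘ a`. -/
theorem flat_ker {R P Q : Type*} [CommRing R] [AddCommGroup P] [Module R P]
    [AddCommGroup Q] [Module R Q] [Module.Flat R P] [Module.Flat R Q] (q : P →ₗ[R] Q)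
    (hq : Function.Surjective q) : Module.Flat R (LinearMap.ker q) := by
  refine Module.Flat.of_forall_exists_factorization fun {l f x} hxf ↦ ?_
  obtain ⟨k, a, y, hya, haf⟩ := Module.Flat.exists_factorization_of_apply_eq_zero_of_free
    (f := f) (x := (LinearMap.ker q).subtype ∘ₗ x) (by simp [hxf])
  have h0 : (q ∘ₗ y) ∘ₗ a = 0 := by
    rw [LinearMap.comp_assoc, ← hya]; ext; simp
  obtain ⟨m, b, z, hzb, hba⟩ := Module.Flat.exists_factorization_of_comp_eq_zero_of_free h0
  obtain ⟨z', hz'⟩ := Module.projective_lifting_property q z hq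
  refine ⟨k, a, (y - z' ∘ₗ b).codRestrict _ fun w ↦ ?_, ?_, haf⟩
  · have h1 := LinearMap.congr_fun hzb w
    have h2 := LinearMap.congr_fun hz' (b w)
    simp only [LinearMap.comp_apply] at h1 h2
    simp [h1, h2]
  · refine LinearMap.ext fun w ↦ Subtype.ext ?_
    have h1 := LinearMap.congr_fun hya w
    have h2 := LinearMap.congr_fun hba w
    simp only [LinearMap.comp_apply, Submodule.subtype_apply, LinearMap.zero_apply] at h1 h2
    simp [h1, h2]

instance flat_prod {R M N : Type*} [CommRing R] [AddCommGroup M] [Module R M] [AddCommGroup N]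
    [Module R N] [Module.Flat R M] [Module.Flat R N] : Module.Flat R (M × N) := by
  rw [Module.Flat.iff_rTensor_injective']
  intro I
  have h : (TensorProduct.prodRight R R R M N).toLinearMap ∘ₗ (I.subtype.rTensor (M × N)) =
      ((I.subtype.rTensor M).prodMap (I.subtype.rTensor N)) ∘ₗ
        (TensorProduct.prodRight R R I M N).toLinearMap := by
    ext <;> simp
  refine Function.Injective.of_comp (f := TensorProduct.prodRight R R R M N) ?_
  have h' : TensorProduct.prodRight R R R M N ∘ I.subtype.rTensor (M × N) =
      Prod.map (I.subtype.rTensor M) (I.subtype.rTensor N) ∘ TensorProduct.prodRight R R I M N :=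
    congrArg DFunLike.coe h
  rw [h']
  exact ((Module.Flat.rTensor_preserves_injective_linearMap _ I.injective_subtype).prodMap
    (Module.Flat.rTensor_preserves_injective_linearMap _ I.injective_subtype)).comp
    (LinearEquiv.injective _)

/-- Schanuel's trick: I is the kernel of a surjection from `F 1 × R` onto `F 0`, both flat. -/
theorem flat_ideal_of_flatDim_quotient_le_one {R : Type u} [CommRing R] {I : Ideal R}
    (h : flatDim R (R ⧸ I) ≤ 1) : Module.Flat R I := by
  obtain ⟨n, hn, F, d, ε, hF, hε, hd0, hd, hs⟩ :
      ∃ n ≤ 1, HasFlatResolutionOfLength R (R ⧸ I) n := by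
    by_contra! hne
    have : (2 : ℕ∞) ≤ flatDim R (R ⧸ I) := by
      refine le_iInf₂ fun n hn ↦ ?_
      have : 2 ≤ n := by
        by_contra! hlt
        exact hne n (by lia) hn
      exact_mod_cast this
    exact absurd (this.trans h) (by decide)
  have := hs 2 (by lia)
  have := hF 0
  have := hF 1
  have hinj : Function.Injective (d 0) := by
    rw [injective_iff_map_eq_zero]
    intro x hx
    obtain ⟨y, rfl⟩ := (hd 0 x).1 hx
    rw [Subsingleton.elim y 0, map_zero]
  -- `e` lifts 1, so `r ↦ r • e` lifts the quotient map R → R/I to `F 0`.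
  obtain ⟨e, he⟩ := hε 1
  let q : (F 1 × R) →ₗ[R] F 0 := (d 0).coprod (LinearMap.toSpanSingleton R _ e)
  have hεe (r : R) : ε (r • e) = Ideal.Quotient.mk I r := by
    rw [map_smul, he, Algebra.smul_def, mul_one]; rfl
  have hq : Function.Surjective q := by
    intro x
    obtain ⟨r, hr⟩ := Ideal.Quotient.mk_surjective (ε x)
    obtain ⟨y, hy⟩ := (hd0 (x - r • e)).1 (by rw [map_sub, hεe, hr, sub_self])
    exact ⟨(y, r), by simp [q, hy]⟩
  have hflat := flat_ker q hq
  let g : LinearMap.ker q →ₗ[R] I :=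
    (LinearMap.snd R (F 1) R ∘ₗ (LinearMap.ker q).subtype).codRestrict I fun x ↦ by
      have hx : d 0 x.1.1 + x.1.2 • e = 0 := x.2
      have := congrArg ε hx
      rwa [map_add, hd0.apply_apply_eq_zero, zero_add, hεe, map_zero,
        Ideal.Quotient.eq_zero_iff_mem] at this
  refine .of_linearEquiv (LinearEquiv.ofBijective g ⟨?_, ?_⟩).symm
  · rw [injective_iff_map_eq_zero]
    intro x hx
    have hx2 : x.1.2 = 0 := congrArg Subtype.val hx
    have hx1 : d 0 x.1.1 + x.1.2 • e = 0 := x.2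
    rw [hx2, zero_smul, add_zero, ← map_zero (d 0)] at hx1
    exact Subtype.ext (Prod.ext (hinj hx1) hx2)
  · intro r
    obtain ⟨y, hy⟩ := (hd0 ((r : R) • e)).1
      (by rw [hεe, Ideal.Quotient.eq_zero_iff_mem]; exact r.2)
    exact ⟨⟨(-y, r), by simp [q, hy]⟩, rfl⟩

theorem flatDim_le_one_of_flat_ker {R M F : Type u} [CommRing R] [AddCommGroup M] [Module R M]
    [AddCommGroup F] [Module R F] [Module.Flat R F] (φ : F →ₗ[R] M)
    (hφ : Function.Surjective φ) (h : Module.Flat R (LinearMap.ker φ)) : flatDim R M ≤ 1 := by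
  refine iInf₂_le 1 ⟨fun
    | 0 => .of R F
    | 1 => .of R (LinearMap.ker φ)
    | _ + 2 => .of R PUnit.{u+1}, fun
    | 0 => (LinearMap.ker φ).subtype
    | _ + 1 => 0, φ, fun
    | 0 => ‹_›
    | 1 => h
    | _ + 2 => inferInstanceAs (Module.Flat R PUnit.{u+1}), hφ,
    LinearMap.exact_subtype_ker_map φ, fun
    | 0 => ?_
    | _ + 1 => ?_, fun
    | 0, h => ?_
    | 1, h => ?_
    | _ + 2, _ => inferInstanceAs (Subsingleton PUnit.{u+1})⟩
  · intro x
    simp only [LinearMap.zero_apply, Set.mem_range, exists_const]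
    exact ⟨fun hx ↦ (Subtype.ext hx).symm, fun hx ↦ hx ▸ rfl⟩
  · intro x
    exact ⟨fun _ ↦ ⟨0, Subsingleton.elim (α := PUnit.{u+1}) _ _⟩, fun _ ↦ rfl⟩
  · lia
  · lia

/-! ### Splitting off projective images; flatness from finite pieces -/

theorem exists_bijective_to_ker_prod_range {R M N : Type*} [CommRing R] [AddCommGroup M] [Module R M]
    [AddCommGroup N] [Module R N] (p : M →ₗ[R] N) [Module.Projective R (LinearMap.range p)] :
    ∃ e : M →ₗ[R] LinearMap.ker p × LinearMap.range p, Function.Bijective e := by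
  obtain ⟨t, ht⟩ := Module.projective_lifting_property p.rangeRestrict LinearMap.id
    p.surjective_rangeRestrict
  have htp (x) : p (t x) = x := congrArg Subtype.val (LinearMap.congr_fun ht x)
  have htp' (x) : p.rangeRestrict (t x) = x := LinearMap.congr_fun ht x
  let π : M →ₗ[R] LinearMap.ker p := (LinearMap.id - t ∘ₗ p.rangeRestrict).codRestrict _
    fun x ↦ by simp [htp]
  refine ⟨π.prod p.rangeRestrict, (injective_iff_map_eq_zero _).2 fun x hx ↦ ?_, fun y ↦ ?_⟩
  · have h1 : x - t (p.rangeRestrict x) = 0 := congrArg (fun y ↦ (y.1 : M)) hx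
    have h2 : p.rangeRestrict x = 0 := congrArg Prod.snd hx
    rwa [h2, map_zero, sub_zero] at h1
  · have h1 : p.rangeRestrict y.1 = 0 := Subtype.ext y.1.2
    refine ⟨y.1 + t y.2, Prod.ext (Subtype.ext ?_) ?_⟩
    · simp [π, h1, htp']
    · simp [h1, htp']

theorem projective_of_projective_inf_ker {R M N : Type*} [CommRing R] [AddCommGroup M]
    [Module R M] [AddCommGroup N] [Module R N] {K : Submodule R M} {p : M →ₗ[R] N}
    (h : Module.Projective R (K ⊓ LinearMap.ker p : Submodule R M))
    (h' : Module.Projective R (K.map p)) : Module.Projective R K := by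
  rw [← LinearMap.range_domRestrict] at h'
  rw [← Submodule.map_comap_subtype] at h
  have : Module.Projective R ((LinearMap.ker (p.domRestrict K)).map K.subtype) := h
  have : Module.Projective R (LinearMap.ker (p.domRestrict K)) :=
    .of_equiv (Submodule.equivMapOfInjective K.subtype K.injective_subtype _).symm
  obtain ⟨e, he⟩ := exists_bijective_to_ker_prod_range (p.domRestrict K)
  exact .of_equiv (LinearEquiv.ofBijective e he).symm

/-- The intersection is a direct summand of K, hence a quotient of it. -/
theorem fg_inf_ker_of_projective_map {R M N : Type*} [CommRing R] [AddCommGroup M]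
    [Module R M] [AddCommGroup N] [Module R N] {K : Submodule R M} {p : M →ₗ[R] N} (hK : K.FG)
    (h : Module.Projective R (K.map p)) : (K ⊓ LinearMap.ker p).FG := by
  have : Module.Finite R K := .of_fg hK
  rw [← LinearMap.range_domRestrict] at h
  obtain ⟨e, he⟩ := exists_bijective_to_ker_prod_range (p.domRestrict K)
  have hfg : (LinearMap.ker (p.domRestrict K)).FG := Module.Finite.iff_fg.1 <|
    .of_surjective (LinearMap.fst R _ _ ∘ₗ e) (Prod.fst_surjective.comp he.2)
  rw [← Submodule.map_comap_subtype]
  exact hfg.map _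

/-- A linear relation involves finitely many elements, so it can be trivialized inside a flat `K'`.
-/
theorem flat_of_forall_exists_flat_le {R M : Type*} [CommRing R] [AddCommGroup M] [Module R M]
    {K : Submodule R M} (h : ∀ (l : ℕ) (x : Fin l → M), (∀ j, x j ∈ K) →
      ∃ K' ≤ K, Module.Flat R K' ∧ ∀ j, x j ∈ K') : Module.Flat R K := by
  refine Module.Flat.of_forall_isTrivialRelation fun {l a x} hx ↦ ?_
  obtain ⟨K', hle, _, hxK'⟩ := h l (fun j ↦ x j) fun j ↦ (x j).2
  have hrel : ∑ j, a j • (⟨x j, hxK' j⟩ : K') = 0 := by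
    refine Subtype.ext ?_
    simpa using congrArg Subtype.val hx
  obtain ⟨k, b, y, hxy, hab⟩ := Module.Flat.isTrivialRelation_of_sum_smul_eq_zero hrel
  refine ⟨k, b, fun j ↦ Submodule.inclusion hle (y j), fun i ↦ ?_, hab⟩
  refine Eq.trans ?_ (congrArg (Submodule.inclusion hle) (hxy i)) |>.trans ?_
  · rfl
  · simp

/-! ### Homogeneous components in free modules -/

section Components

variable {Γ : Type v} {R : Type u} [DecidableEq Γ] [AddCancelMonoid Γ] [CommRing R]
variable (𝒜 : Γ → AddSubgroup R) [GradedRing 𝒜]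
variable {ι : Type*} (f : Γ → Γ → Γ) (deg : ι → Γ)

/-- The decomposition of an element of the free module `ι →₀ R` into homogeneous components, where
an element of degree `α` in the `i`-th summand is given the degree `f α (deg i)`. -/
noncomputable def components : (ι →₀ R) →+ (Γ →₀ (ι →₀ R)) :=
  Finsupp.liftAddHom fun i ↦
    (DirectSum.toAddMonoid fun α ↦ (Finsupp.singleAddHom (f α (deg i))).comp
      ((Finsupp.singleAddHom i).comp (𝒜 α).subtype)).comp
    (DirectSum.decomposeAddEquiv 𝒜).toAddMonoidHom

theorem components_single {i : ι} {α : Γ} {r : R} (hr : r ∈ 𝒜 α) :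
    components 𝒜 f deg (Finsupp.single i r) =
      Finsupp.single (f α (deg i)) (Finsupp.single i r) := by
  simp [components, DirectSum.decompose_of_mem 𝒜 hr]

variable {𝒜} in
theorem addHom_ext_of_homogeneous {N : Type*} [AddZeroClass N] {φ ψ : (ι →₀ R) →+ N}
    (h : ∀ i α, ∀ r ∈ 𝒜 α, φ (Finsupp.single i r) = ψ (Finsupp.single i r)) : φ = ψ := by
  refine Finsupp.addHom_ext fun i r ↦ ?_
  induction r using DirectSum.Decomposition.inductionOn 𝒜 with
  | zero => simp
  | homogeneous r => exact h i _ r r.2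
  | add r s hr hs => rw [Finsupp.single_add, map_add, map_add, hr, hs]

theorem sum_components (x : ι →₀ R) : (components 𝒜 f deg x).sum (fun _ y ↦ y) = x := by
  suffices (Finsupp.liftAddHom fun _ ↦ AddMonoidHom.id (ι →₀ R)).comp (components 𝒜 f deg) =
      AddMonoidHom.id (ι →₀ R) from DFunLike.congr_fun this x
  refine addHom_ext_of_homogeneous (𝒜 := 𝒜) fun i α r hr ↦ ?_
  simp [components_single 𝒜 f deg hr]

theorem components_components (x : ι →₀ R) (γ : Γ) :
    components 𝒜 f deg (components 𝒜 f deg x γ) = Finsupp.single γ (components 𝒜 f deg x γ) := by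
  suffices (components 𝒜 f deg).comp ((Finsupp.applyAddHom γ).comp (components 𝒜 f deg)) =
      (Finsupp.singleAddHom γ).comp ((Finsupp.applyAddHom γ).comp (components 𝒜 f deg)) from
    DFunLike.congr_fun this x
  refine addHom_ext_of_homogeneous (𝒜 := 𝒜) fun i α r hr ↦ ?_
  by_cases h : f α (deg i) = γ
  · subst h
    simp [components_single 𝒜 f deg hr]
  · simp [components_single 𝒜 f deg hr, Finsupp.single_eq_of_ne' h]

/-- Here `f` gives degrees for the action and `g` for ring multiplication. Both are `α + β` for left
modules and `β + α` for right ones, so one argument serves both sides. -/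
theorem components_smul {g : Γ → Γ → Γ} (hfg : ∀ α β γ, f (g α β) γ = f α (f β γ))
    (hg : ∀ α β, ∀ r ∈ 𝒜 α, ∀ s ∈ 𝒜 β, r * s ∈ 𝒜 (g α β)) {α : Γ} {r : R} (hr : r ∈ 𝒜 α)
    (x : ι →₀ R) : components 𝒜 f deg (r • x) =
      (components 𝒜 f deg x).sum fun γ y ↦ Finsupp.single (f α γ) (r • y) := by
  suffices (components 𝒜 f deg).comp (DistribSMul.toAddMonoidHom (ι →₀ R) r) =
      (Finsupp.liftAddHom fun γ ↦ (Finsupp.singleAddHom (f α γ)).comp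
        (DistribSMul.toAddMonoidHom (ι →₀ R) r)).comp (components 𝒜 f deg) from
    DFunLike.congr_fun this x
  refine addHom_ext_of_homogeneous (𝒜 := 𝒜) fun i β s hs ↦ ?_
  change components 𝒜 f deg (r • Finsupp.single i s) =
    (components 𝒜 f deg (Finsupp.single i s)).sum fun γ y ↦ Finsupp.single (f α γ) (r • y)
  rw [Finsupp.smul_single, smul_eq_mul, components_single 𝒜 f deg hs,
    components_single 𝒜 f deg (hg α β r hr s hs), Finsupp.sum_single_index (by simp), hfg,
    Finsupp.smul_single, smul_eq_mul]

theorem components_apply_apply (x : ι →₀ R) (γ : Γ) (i : ι) :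
    components 𝒜 f deg x γ i = components 𝒜 f deg (Finsupp.single i (x i)) γ i := by
  let e : (Γ →₀ ι →₀ R) →+ R := (Finsupp.applyAddHom i).comp (Finsupp.applyAddHom γ)
  suffices e.comp (components 𝒜 f deg) = (e.comp (components 𝒜 f deg)).comp
      ((Finsupp.singleAddHom i).comp (Finsupp.applyAddHom i)) from DFunLike.congr_fun this x
  refine addHom_ext_of_homogeneous (𝒜 := 𝒜) fun j β s hs ↦ ?_
  by_cases h : j = i
  · subst h; simp
  · by_cases h' : f β (deg j) = γ
    · subst h'
      simp [e, components_single 𝒜 f deg hs, Finsupp.single_eq_of_ne' h]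
    · simp [e, components_single 𝒜 f deg hs, Finsupp.single_eq_of_ne' h,
        Finsupp.single_eq_of_ne' h']

/-- Injectivity of `f · β`, which is cancellation in Γ, lets the degree in R be recovered from the
degree in the free module. Thus coordinate projections send component-closed submodules to
homogeneous ideals. -/
theorem decompose_apply_eq_components (hf : ∀ β, Function.Injective (f · β)) (x : ι →₀ R) (i : ι)
    (α : Γ) : (decompose 𝒜 (x i) α : R) = components 𝒜 f deg x (f α (deg i)) i := by
  rw [components_apply_apply]
  induction x i using DirectSum.Decomposition.inductionOn 𝒜 with
  | zero => simp
  | homogeneous r =>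
    rename_i β
    rw [components_single 𝒜 f deg r.2]
    by_cases h : β = α
    · subst h; simp
    · rw [DirectSum.decompose_of_mem_ne 𝒜 r.2 h,
        Finsupp.single_eq_of_ne' (fun h' ↦ h (hf _ h')), Finsupp.zero_apply]
  | add r s hr hs => simp [decompose_add, hr, hs]

theorem decompose_linearCombination {M : Type*} [AddCommGroup M] [Module R M]
    (ℳ : Γ → AddSubgroup M) [DirectSum.Decomposition ℳ]
    (hℳ : ∀ α β, ∀ r ∈ 𝒜 α, ∀ m ∈ ℳ β, r • m ∈ ℳ (f α β)) (v : ι → M) (hv : ∀ i, v i ∈ ℳ (deg i))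
    (x : ι →₀ R) (γ : Γ) : (decompose ℳ (Finsupp.linearCombination R v x) γ : M) =
      Finsupp.linearCombination R v (components 𝒜 f deg x γ) := by
  let e : M →+ M :=
    { toFun m := decompose ℳ m γ, map_zero' := by simp, map_add' := by simp [decompose_add] }
  suffices e.comp (Finsupp.linearCombination R v).toAddMonoidHom =
      (Finsupp.linearCombination R v).toAddMonoidHom.comp
        ((Finsupp.applyAddHom γ).comp (components 𝒜 f deg)) from DFunLike.congr_fun this x
  refine addHom_ext_of_homogeneous (𝒜 := 𝒜) fun i α r hr ↦ ?_
  have hmem := hℳ _ _ r hr _ (hv i)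
  by_cases h : f α (deg i) = γ
  · subst h
    simp [e, components_single 𝒜 f deg hr, DirectSum.decompose_of_mem_same ℳ hmem]
  · simp [e, components_single 𝒜 f deg hr, DirectSum.decompose_of_mem_ne ℳ hmem h,
      Finsupp.single_eq_of_ne' h]

/-- A submodule of `ι →₀ R` is closed under taking homogeneous components. -/
def IsComponentClosed (K : Submodule R (ι →₀ R)) : Prop :=
  ∀ x ∈ K, ∀ γ, components 𝒜 f deg x γ ∈ K

theorem isComponentClosed_span {g : Γ → Γ → Γ} (hfg : ∀ α β γ, f (g α β) γ = f α (f β γ))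
    (hg : ∀ α β, ∀ r ∈ 𝒜 α, ∀ s ∈ 𝒜 β, r * s ∈ 𝒜 (g α β)) {S : Set (ι →₀ R)}
    (hS : ∀ x ∈ S, ∀ γ, components 𝒜 f deg x γ ∈ Submodule.span R S) :
    IsComponentClosed 𝒜 f deg (Submodule.span R S) := by
  intro x hx
  induction hx using Submodule.span_induction with
  | mem x hx => exact hS x hx
  | zero => simp
  | add x y _ _ hx hy => intro γ; simpa using add_mem (hx γ) (hy γ)
  | smul r x _ hx =>
    induction r using DirectSum.Decomposition.inductionOn 𝒜 with
    | zero => simp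
    | homogeneous r =>
      intro γ
      rw [components_smul 𝒜 f deg hfg hg r.2, Finsupp.sum_apply]
      refine sum_mem fun δ _ ↦ ?_
      dsimp only
      rw [Finsupp.single_apply]
      split_ifs
      · exact Submodule.smul_mem _ _ (hx δ)
      · exact zero_mem _
    | add r s hr hs =>
      intro γ
      rw [add_smul, map_add, Finsupp.add_apply]
      exact add_mem (hr γ) (hs γ)

theorem exists_fg_isComponentClosed {g : Γ → Γ → Γ} (hfg : ∀ α β γ, f (g α β) γ = f α (f β γ))
    (hg : ∀ α β, ∀ r ∈ 𝒜 α, ∀ s ∈ 𝒜 β, r * s ∈ 𝒜 (g α β)) {K : Submodule R (ι →₀ R)}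
    (hK : IsComponentClosed 𝒜 f deg K) {l : ℕ} (x : Fin l → ι →₀ R) (hx : ∀ j, x j ∈ K) :
    ∃ K' ≤ K, K'.FG ∧ IsComponentClosed 𝒜 f deg K' ∧ ∀ j, x j ∈ K' := by
  classical
  let T : Finset (ι →₀ R) := Finset.univ.biUnion fun j ↦
    (components 𝒜 f deg (x j)).support.image (components 𝒜 f deg (x j))
  have hT (j γ) : components 𝒜 f deg (x j) γ ∈ Submodule.span R (T : Set (ι →₀ R)) := by
    by_cases h : components 𝒜 f deg (x j) γ = 0
    · rw [h]; exact zero_mem _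
    · refine Submodule.subset_span ?_
      simp only [T, Finset.coe_biUnion, Finset.mem_coe, Finset.mem_univ, Set.iUnion_true,
        Set.mem_iUnion, Finset.mem_image]
      exact ⟨j, γ, by simpa using h, rfl⟩
  refine ⟨Submodule.span R T, ?_, ⟨T, rfl⟩, isComponentClosed_span 𝒜 f deg hfg hg ?_, fun j ↦ ?_⟩
  · rw [Submodule.span_le]
    intro y hy
    simp only [T, Finset.coe_biUnion, Finset.mem_coe, Finset.mem_univ, Set.iUnion_true,
        Set.mem_iUnion, Finset.mem_image] at hy
    obtain ⟨j, γ, _, rfl⟩ := hy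
    exact hK _ (hx j) γ
  · intro y hy γ
    have hy' := Submodule.subset_span (R := R) hy
    simp only [T, Finset.coe_biUnion, Finset.mem_coe, Finset.mem_univ, Set.iUnion_true,
        Set.mem_iUnion, Finset.mem_image] at hy
    obtain ⟨j, δ, _, rfl⟩ := hy
    rw [components_components, Finsupp.single_apply]
    split_ifs
    · exact hy'
    · exact zero_mem _
  · rw [← sum_components 𝒜 f deg (x j)]
    exact sum_mem fun γ _ ↦ hT j γ

theorem projective_of_isComponentClosed (hf : ∀ β, Function.Injective (f · β))
    (hA : ∀ I : Ideal R, I.IsHomogeneous 𝒜 → I.FG → Module.Projective R I)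
    {K : Submodule R (ι →₀ R)} (hfg : K.FG) (hK : IsComponentClosed 𝒜 f deg K) :
    Module.Projective R K := by
  classical
  have key (s : Finset ι) : ∀ K : Submodule R (ι →₀ R), K.FG → IsComponentClosed 𝒜 f deg K →
      K ≤ Finsupp.supported R R (s : Set ι) → Module.Projective R K := by
    induction s using Finset.induction_on with
    | empty =>
      intro K _ _ hs
      obtain rfl : K = ⊥ := by simpa using hs
      infer_instance
    | insert i s his ih =>
      intro K hfg hK hs
      have hI : Module.Projective R (K.map (Finsupp.lapply i)) := by
        refine hA _ ?_ (hfg.map _)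
        rintro α _ ⟨x, hx, rfl⟩
        exact ⟨_, hK x hx (f α (deg i)), (decompose_apply_eq_components 𝒜 f deg hf x i α).symm⟩
      refine projective_of_projective_inf_ker
        (ih _ (fg_inf_ker_of_projective_map hfg hI) ?_ ?_) hI
      · rintro x ⟨hx, hxi⟩ γ
        refine ⟨hK x hx γ, ?_⟩
        have hxi' : x i = 0 := hxi
        change components 𝒜 f deg x γ i = 0
        rw [components_apply_apply, hxi']
        simp
      · rintro x ⟨hx, hxi⟩
        rw [Finsupp.mem_supported']
        intro k hk
        by_cases hki : k = i
        · subst hki; exact hxi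
        · exact (Finsupp.mem_supported' _ _).1 (hs hx) k (by simpa [hki] using hk)
  obtain ⟨T, rfl⟩ := id hfg
  -- Finitely many generators have finitely many coordinates in their supports.
  refine key (T.biUnion fun x ↦ x.support) _ hfg hK (Submodule.span_le.2 fun x hx ↦ ?_)
  intro i hi
  simp only [Finset.coe_biUnion, Set.mem_iUnion]
  exact ⟨x, hx, hi⟩

theorem flat_of_isComponentClosed {g : Γ → Γ → Γ} (hfg : ∀ α β γ, f (g α β) γ = f α (f β γ))
    (hg : ∀ α β, ∀ r ∈ 𝒜 α, ∀ s ∈ 𝒜 β, r * s ∈ 𝒜 (g α β)) (hf : ∀ β, Function.Injective (f · β))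
    (hA : ∀ I : Ideal R, I.IsHomogeneous 𝒜 → I.FG → Module.Projective R I)
    {K : Submodule R (ι →₀ R)} (hK : IsComponentClosed 𝒜 f deg K) : Module.Flat R K := by
  refine flat_of_forall_exists_flat_le fun l x hx ↦ ?_
  obtain ⟨K', hle, hK'fg, hK', hxK'⟩ := exists_fg_isComponentClosed 𝒜 f deg hfg hg hK x hx
  have := projective_of_isComponentClosed 𝒜 f deg hf hA hK'fg hK'
  exact ⟨K', hle, inferInstance, hxK'⟩

end Components

/-! ### Bounds on the graded weak dimensions -/

section WeakDimension

variable {Γ : Type v} {R : Type u} [DecidableEq Γ] [AddCancelMonoid Γ] [CommRing R]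
variable (𝒜 : Γ → AddSubgroup R) [GradedRing 𝒜]

theorem flatDim_le_one_of_graded {f g : Γ → Γ → Γ} (hfg : ∀ α β γ, f (g α β) γ = f α (f β γ))
    (hg : ∀ α β, ∀ r ∈ 𝒜 α, ∀ s ∈ 𝒜 β, r * s ∈ 𝒜 (g α β)) (hf : ∀ β, Function.Injective (f · β))
    (hA : ∀ I : Ideal R, I.IsHomogeneous 𝒜 → I.FG → Module.Projective R I)
    {M : Type u} [AddCommGroup M] [Module R M] {ℳ : Γ → AddSubgroup M}
    (hℳ : DirectSum.IsInternal ℳ) (hsmul : ∀ α β, ∀ r ∈ 𝒜 α, ∀ m ∈ ℳ β, r • m ∈ ℳ (f α β)) :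
    flatDim R M ≤ 1 := by
  let := hℳ.chooseDecomposition
  let ι := {m : M // ∃ β, m ∈ ℳ β}
  -- A degree must be chosen, since 0 is homogeneous of every degree.
  choose deg hdeg using fun i : ι ↦ i.2
  let φ : (ι →₀ R) →ₗ[R] M := Finsupp.linearCombination R Subtype.val
  refine flatDim_le_one_of_flat_ker φ ?_
    (flat_of_isComponentClosed 𝒜 f deg hfg hg hf hA fun x hx γ ↦ ?_)
  · intro m
    induction m using DirectSum.Decomposition.inductionOn ℳ with
    | zero => exact ⟨0, map_zero _⟩
    | homogeneous m => exact ⟨Finsupp.single ⟨m, _, m.2⟩ 1, by simp [φ]⟩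
    | add m n hm hn =>
      obtain ⟨x, rfl⟩ := hm
      obtain ⟨y, rfl⟩ := hn
      exact ⟨x + y, map_add _ _ _⟩
  · rw [LinearMap.mem_ker] at hx ⊢
    rw [← decompose_linearCombination 𝒜 f deg ℳ hsmul _ hdeg x γ]
    change (decompose ℳ (φ x) γ : M) = 0
    simp [hx]

theorem gradedLeftWeakDim_le_one
    (hA : ∀ I : Ideal R, I.IsHomogeneous 𝒜 → I.FG → Module.Projective R I) :
    gradedLeftWeakDim 𝒜 ≤ 1 := by
  refine sSup_le ?_
  rintro _ ⟨M, _, _, ℳ, ⟨hℳ, hsmul⟩, rfl⟩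
  exact flatDim_le_one_of_graded 𝒜 (f := (· + ·)) (g := (· + ·)) add_assoc
    (fun _ _ _ hr _ hs ↦ SetLike.GradedMul.mul_mem hr hs) add_left_injective hA hℳ
    fun α β r hr m hm ↦ hsmul α β r m hr hm

theorem gradedRightWeakDim_le_one
    (hA : ∀ I : Ideal R, I.IsHomogeneous 𝒜 → I.FG → Module.Projective R I) :
    gradedRightWeakDim 𝒜 ≤ 1 := by
  refine sSup_le ?_
  rintro _ ⟨M, _, _, ℳ, ⟨hℳ, hsmul⟩, rfl⟩
  exact flatDim_le_one_of_graded 𝒜 (f := fun α β ↦ β + α) (g := fun α β ↦ β + α)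
    (fun α β γ ↦ (add_assoc γ β α).symm)
    (fun _ _ r hr s hs ↦ mul_comm s r ▸ SetLike.GradedMul.mul_mem hs hr) add_right_injective hA hℳ
    fun α β r hr m hm ↦ hsmul α β r m hr hm

variable {𝒜} in
-- A family of components summing to 0 in R/I lifts to some `r ∈ I`, whose components lie in I by
-- homogeneity.
theorem isInternal_map_quotientMk {I : Ideal R} (hI : I.IsHomogeneous 𝒜) :
    DirectSum.IsInternal fun α ↦ (𝒜 α).map (Ideal.Quotient.mk I).toAddMonoidHom := by
  classical
  set ℳ : Γ → AddSubgroup (R ⧸ I) := fun α ↦ (𝒜 α).map (Ideal.Quotient.mk I).toAddMonoidHom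
  let q : (⨁ α, 𝒜 α) →+ ⨁ α, ℳ α := DirectSum.map fun α ↦
    (Ideal.Quotient.mk I).toAddMonoidHom.addSubgroupMap (𝒜 α)
  have hq : Function.Surjective q := (DirectSum.map_surjective _).2 fun α ↦
    AddMonoidHom.addSubgroupMap_surjective _ _
  have hcoe (r : R) : DirectSum.coeAddMonoidHom ℳ (q (decompose 𝒜 r)) = Ideal.Quotient.mk I r := by
    induction r using DirectSum.Decomposition.inductionOn 𝒜 with
    | zero => simp
    | homogeneous r =>
      simp only [decompose_coe, q, DirectSum.map_of, DirectSum.coeAddMonoidHom_of]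
      rfl
    | add r s hr hs => rw [decompose_add, map_add, map_add, map_add, hr, hs]
  refine ⟨(injective_iff_map_eq_zero _).2 fun x hx ↦ ?_, fun y ↦ ?_⟩
  · obtain ⟨x, rfl⟩ := hq x
    obtain ⟨r, rfl⟩ := (decompose 𝒜).surjective x
    rw [hcoe, Ideal.Quotient.eq_zero_iff_mem] at hx
    refine DFinsupp.ext fun α ↦ Subtype.ext ?_
    exact Ideal.Quotient.eq_zero_iff_mem.2 (hI α hx)
  · obtain ⟨r, rfl⟩ := Ideal.Quotient.mk_surjective y
    exact ⟨_, hcoe r⟩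

theorem flatDim_quotient_le_gradedLeftWeakDim {I : Ideal R} (hI : I.IsHomogeneous 𝒜) :
    flatDim R (R ⧸ I) ≤ gradedLeftWeakDim 𝒜 := by
  refine le_sSup ⟨R ⧸ I, inferInstance, inferInstance, _, ⟨isInternal_map_quotientMk hI, ?_⟩, rfl⟩
  rintro α β r _ hr ⟨s, hs, rfl⟩
  exact ⟨r * s, SetLike.GradedMul.mul_mem hr hs, rfl⟩

theorem flatDim_quotient_le_gradedRightWeakDim {I : Ideal R} (hI : I.IsHomogeneous 𝒜) :
    flatDim R (R ⧸ I) ≤ gradedRightWeakDim 𝒜 := by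
  refine le_sSup ⟨R ⧸ I, inferInstance, inferInstance, _, ⟨isInternal_map_quotientMk hI, ?_⟩, rfl⟩
  rintro α β r _ hr ⟨s, hs, rfl⟩
  exact ⟨r * s, mul_comm s r ▸ SetLike.GradedMul.mul_mem hs hr, rfl⟩

end WeakDimension

/-! ### The equivalences -/

section Main

variable {Γ : Type v} {R : Type u} [DecidableEq Γ] [AddCancelMonoid Γ] [CommRing R]
variable (𝒜 : Γ → AddSubgroup R) [GradedRing 𝒜]

variable {𝒜} in
theorem IsGradedCoherent.projective (hc : IsGradedCoherent 𝒜) {I : Ideal R}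
    (hI : I.IsHomogeneous 𝒜) (hfg : I.FG) (h : flatDim R (R ⧸ I) ≤ 1) : Module.Projective R I := by
  have := hc I hI hfg
  have := flat_ideal_of_flatDim_quotient_le_one h
  exact Module.Flat.projective_of_finitePresentation

theorem isGradedCoherent_of_projective
    (hA : ∀ I : Ideal R, I.IsHomogeneous 𝒜 → I.FG → Module.Projective R I) :
    IsGradedCoherent 𝒜 := by
  intro I hI hfg
  have := hA I hI hfg
  have : Module.Finite R I := .of_fg hfg
  exact Module.finitePresentation_of_projective R I

theorem isGradedPrufer_iff_projective [IsDomain R] :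
    IsGradedPrufer 𝒜 ↔
      ∀ I : Ideal R, I.IsHomogeneous 𝒜 → I.FG → I ≠ ⊥ → Module.Projective R I :=
  ⟨fun h I hI hfg h0 ↦ projective_of_isUnit_coeIdeal (h I hI hfg h0), fun h I hI hfg h0 ↦
    have := h I hI hfg h0
    isUnit_coeIdeal_of_projective h0⟩

variable {𝒜} in
theorem IsGradedPrufer.projective [IsDomain R] (h : IsGradedPrufer 𝒜) (I : Ideal R)
    (hI : I.IsHomogeneous 𝒜) (hfg : I.FG) : Module.Projective R I := by
  by_cases h0 : I = ⊥
  · subst h0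
    infer_instance
  · exact (isGradedPrufer_iff_projective 𝒜).1 h I hI hfg h0

end Main

end GradedPrufer

theorem corollary2p12 {Γ : Type*} {R : Type*} [DecidableEq Γ] [AddCancelMonoid Γ]
    [CommRing R] [IsDomain R] (𝒜 : Γ → AddSubgroup R) [GradedRing 𝒜] :
    (GradedPrufer.IsGradedPrufer 𝒜 ↔
      GradedPrufer.IsGradedCoherent 𝒜 ∧ GradedPrufer.gradedLeftWeakDim 𝒜 ≤ 1) ∧
    (GradedPrufer.IsGradedPrufer 𝒜 ↔
      GradedPrufer.IsGradedCoherent 𝒜 ∧ GradedPrufer.gradedRightWeakDim 𝒜 ≤ 1) ∧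
    (GradedPrufer.IsGradedPrufer 𝒜 ↔
      ∀ I : Ideal R, I.IsHomogeneous 𝒜 → I.FG → I ≠ ⊥ → Module.Projective R I) := by
  open GradedPrufer in
  refine ⟨⟨fun h ↦ ⟨isGradedCoherent_of_projective 𝒜 h.projective,
    gradedLeftWeakDim_le_one 𝒜 h.projective⟩, fun ⟨hc, hd⟩ ↦ ?_⟩,
    ⟨fun h ↦ ⟨isGradedCoherent_of_projective 𝒜 h.projective,
      gradedRightWeakDim_le_one 𝒜 h.projective⟩, fun ⟨hc, hd⟩ ↦ ?_⟩,
    isGradedPrufer_iff_projective 𝒜⟩ <;>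
  refine (GradedPrufer.isGradedPrufer_iff_projective 𝒜).2 fun I hI hfg _ ↦ hc.projective hI hfg ?_
  · exact (GradedPrufer.flatDim_quotient_le_gradedLeftWeakDim 𝒜 hI).trans hd
  · exact (GradedPrufer.flatDim_quotient_le_gradedRightWeakDim 𝒜 hI).trans hd
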